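/- **Theorem (correctness of the ES procedure).** Let $n\in\mathbb N$ and let $f=(f_1,\dots,f_n)$ with $f_i\in\mathbb R[x_1,\dots,x_n]$ be a polynomial vector field. Formulas are built with $\land,\lor,\lnot$ from the atoms $\mathbf T$, $\mathbf F$, $p<0$, $p=0$ ($p\in\mathbb R[x_1,\dots,x_n]$); a formula is identified with the semi-algebraic subset of $\mathbb R^n$ that it describes, and $p\ne0$ abbreviates $(-p<0)\lor(p<0)$. A set $S\subseteq\mathbb R^n$ is *positively invariant* for $x'=f(x)$ if every solution $\gamma$ of $x'=f(x)$ on an open interval $J\ni 0$ with $\gamma(0)\in S$ satisfies $\gamma(t)\in S$ for all $t\in J$ with $t\ge0$. For a polynomial $p$ put $p'=\sum_i \frac{\partial p}{\partial x_i}f_i$, $p^{(0)}=p$, $p^{(k+1)}=(p^{(k)})'$, and let $\mathrm{ord}_f(p)$ be the least $k$ such that $\langle p,\dots,p^{(k)}\rangle=\langle p,\dots,p^{(K)}\rangle$ for all $K\ge k$. Fix a monomial order. Let $\mathrm{rem}_0=p$, and let $\mathrm{rem}_{i+1}$ be the remainder of the multivariate division of $\mathrm{rem}_i'$ by $\mathrm{rem}_0,\dots,\mathrm{rem}_i$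 (by the standard division algorithm; divisors equal to the zero polynomial are skipped). Define, on atoms, $$\mathrm{In}_f(\mathbf T)=\mathbf T,\quad \mathrm{In}_f(\mathbf F)=\mathbf F,\quad \mathrm{In}_f(p=0)=\bigwedge_{i=0}^{\mathrm{ord}_f(p)}\mathrm{rem}_i=0,\quad \mathrm{In}_f(p<0)=\bigvee_{i=0}^{\mathrm{ord}_f(p)}\Big(\bigwedge_{j<i}\mathrm{rem}_j=0\ \land\ \mathrm{rem}_i<0\Big),$$ $$\mathrm{Exit}_f(\mathbf T)=\mathrm{Exit}_f(\mathbf F)=\mathrm{Exit}_f(p<0)=\mathbf F,\qquad \mathrm{Exit}_f(p=0)=\bigvee_{i=1}^{\mathrm{ord}_f(p)}\Big(\bigwedge_{j<i}\mathrm{rem}_j=0\ \land\ \mathrm{rem}_i\neq0\Big),$$ and extend $\mathrm{In}_f$ to all formulas by replacing every atom $A$ by $\mathrm{In}_f(A)$. Let $\mathrm{Neg}(\mathbf F)=\mathbf T$, $\mathrm{Neg}(\mathbf T)=\mathbf F$, $\mathrm{Neg}(p<0)=(-p<0)\lor(-p=0)$, $\mathrm{Neg}(p=0)=(-p<0)\lor(p<0)$,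 $\mathrm{Neg}(S_1\land S_2)=\lnot S_1\lor\lnot S_2$, $\mathrm{Neg}(S_1\lor S_2)=\lnot S_1\land\lnot S_2$, $\mathrm{Neg}(\lnot S)=S$. Let $\mathrm{Reduce}$ be a quantifier-elimination oracle, i.e. a Boolean function which returns True on $\exists x_1\dots\exists x_n.\,\varphi$ ($\varphi$ a formula) if and only if this sentence holds in $\mathbb R$. Define the Boolean-valued procedure $\mathrm{NonEmpty}_f$ on pairs of formulas by terminating recursion: $$\begin{aligned} \mathrm{NonEmpty}_f(A,R)&=\mathrm{Reduce}(\exists x_1\dots\exists x_n.\ \mathrm{Exit}_f(A)\land R)\quad(A\text{ an atom}),\\ \mathrm{NonEmpty}_f(S_1\land S_2,R)&=\mathrm{NonEmpty}_f(S_1,S_2\land R)\lor\mathrm{NonEmpty}_f(S_2,S_1\land R),\\ \mathrm{NonEmpty}_f(S_1\lor S_2,R)&=\mathrm{NonEmpty}_f(S_1,\lnot\mathrm{In}_f(S_2)\land R)\lor\mathrm{NonEmpty}_f(S_2,\lnot\mathrm{In}_f(S_1)\land R),\\ \mathrm{NonEmpty}_f(\lnot S,R)&=\mathrm{NonEmpty}_f(\mathrm{Neg}(S),R).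 \end{aligned}$$ Then for every formula $S$, the semi-algebraic set $S$ is positively invariant for $x'=f(x)$ if and only if $$\lnot\big(\mathrm{NonEmpty}_f(S,\mathbf T)\lor\mathrm{NonEmpty}_{-f}(\lnot S,\mathbf T)\big).$$ Consequently the Boolean procedure $\mathbf{ES}(S,f):=\lnot\big(\mathrm{NonEmpty}_f(S,\mathbf T)\lor\mathrm{NonEmpty}_{-f}(\lnot S,\mathbf T)\big)$, which uses the oracle only through these calls to $\mathrm{Reduce}$, returns True exactly when $S$ is positively invariant. -/

import Mathlib

open MvPolynomial

namespace ExitSets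

noncomputable section

/-! ### Polynomial systems of ODEs and positive invariance -/

/-- The vector field on `ℝⁿ` given by the polynomials `f₁, …, fₙ`. -/
def vectorField {n : ℕ} (f : Fin n → MvPolynomial (Fin n) ℝ) (x : Fin n → ℝ) : Fin n → ℝ :=
  fun i => eval x (f i)

/-- `γ` is a solution of `x' = f(x)` with initial value `x`, on the open interval `J ∋ 0`. -/
def IsSolution {n : ℕ} (f : Fin n → MvPolynomial (Fin n) ℝ) (x : Fin n → ℝ)
    (J : Set ℝ) (γ : ℝ → Fin n → ℝ) : Prop :=
  IsOpen J ∧ J.OrdConnected ∧ (0 : ℝ) ∈ J ∧ γ 0 = x ∧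
    IsIntegralCurveOn γ (fun _ => vectorField f) J

/-- No solution starting inside `S` leaves `S` in the future, for as long as it exists. -/
def PositivelyInvariant {n : ℕ} (f : Fin n → MvPolynomial (Fin n) ℝ)
    (S : Set (Fin n → ℝ)) : Prop :=
  ∀ x ∈ S, ∀ (J : Set ℝ) (γ : ℝ → Fin n → ℝ), IsSolution f x J γ →
    ∀ t ∈ J, 0 ≤ t → γ t ∈ S

/-! ### Quantifier-free formulas of real arithmetic -/

/-- Atomic formulas `T`, `F`, `p < 0`, `p = 0`. -/
inductive Atom (n : ℕ) : Type
  | tt : Atom n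
  | ff : Atom n
  | lt (p : MvPolynomial (Fin n) ℝ) : Atom n
  | eq (p : MvPolynomial (Fin n) ℝ) : Atom n

/-- The subset of `ℝⁿ` described by an atomic formula. -/
def Atom.toSet {n : ℕ} : Atom n → Set (Fin n → ℝ)
  | .tt => Set.univ
  | .ff => ∅
  | .lt p => {x | eval x p < 0}
  | .eq p => {x | eval x p = 0}

/-- Quantifier-free formulas; they describe exactly the semi-algebraic subsets of `ℝⁿ`. -/
inductive Formula (n : ℕ) : Type
  | atom (A : Atom n) : Formula n
  | and (S₁ S₂ : Formula n) : Formula n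
  | or (S₁ S₂ : Formula n) : Formula n
  | not (S : Formula n) : Formula n

namespace Formula

variable {n : ℕ}

/-- The semi-algebraic set described by a formula. -/
def toSet : Formula n → Set (Fin n → ℝ)
  | atom A => A.toSet
  | and S₁ S₂ => S₁.toSet ∩ S₂.toSet
  | or S₁ S₂ => S₁.toSet ∪ S₂.toSet
  | not S => S.toSetᶜ

/-- The formula `T`. -/
def tt : Formula n := atom .tt

/-- The formula `F`. -/
def ff : Formula n := atom .ff

/-- The formula `p < 0`. -/
def lt (p : MvPolynomial (Fin n) ℝ) : Formula n := atom (.lt p)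

/-- The formula `p = 0`. -/
def eq (p : MvPolynomial (Fin n) ℝ) : Formula n := atom (.eq p)

/-- `p ≠ 0`, which abbreviates `-p < 0 ∨ p < 0`. -/
def ne (p : MvPolynomial (Fin n) ℝ) : Formula n := or (lt (-p)) (lt p)

/-- Finite conjunction (`T` if the list is empty). -/
def conj (L : List (Formula n)) : Formula n := L.foldr and tt

/-- Finite disjunction (`F` if the list is empty). -/
def disj (L : List (Formula n)) : Formula n := L.foldr or ff

/-- The procedure `Neg`: pushes one negation inside by one level. -/
def neg : Formula n → Formula n
  | atom .ff => tt
  | atom .tt => ff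
  | atom (.lt p) => or (lt (-p)) (eq (-p))
  | atom (.eq p) => or (lt (-p)) (lt p)
  | and S₁ S₂ => or (not S₁) (not S₂)
  | or S₁ S₂ => and (not S₁) (not S₂)
  | not S => S

/-- A size measure, used only to see that the recursion of `NonEmpty` terminates. -/
def weight : Formula n → ℕ
  | atom _ => 1
  | and S₁ S₂ => S₁.weight + S₂.weight + 1
  | or S₁ S₂ => S₁.weight + S₂.weight + 1
  | not S => 4 * S.weight

theorem weight_pos (S : Formula n) : 0 < S.weight := by
  induction S <;> simp [weight]
  assumption

theorem weight_neg_lt (S : Formula n) : (neg S).weight < (not S).weight := by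
  rcases S with (_ | _ | _ | _) | ⟨S₁, S₂⟩ | ⟨S₁, S₂⟩ | S <;>
    simp only [neg, weight, tt, ff, lt, eq] <;> try omega
  have := S.weight_pos
  omega

end Formula

/-! ### Lie derivatives and the order of a polynomial -/

/-- The Lie derivative `p' = ∇p · f`. -/
def lieDeriv {n : ℕ} (f : Fin n → MvPolynomial (Fin n) ℝ) (p : MvPolynomial (Fin n) ℝ) :
    MvPolynomial (Fin n) ℝ :=
  ∑ i, pderiv i p * f i

/-- The ideal `⟨p, p', …, p⁽ᵏ⁾⟩`. -/
def lieIdeal {n : ℕ} (f : Fin n → MvPolynomial (Fin n) ℝ) (p : MvPolynomial (Fin n) ℝ) (k : ℕ) :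
    Ideal (MvPolynomial (Fin n) ℝ) :=
  Ideal.span {q | ∃ i ≤ k, q = (lieDeriv f)^[i] p}

theorem exists_lieIdeal_stable {n : ℕ} (f : Fin n → MvPolynomial (Fin n) ℝ)
    (p : MvPolynomial (Fin n) ℝ) : ∃ k, ∀ K, k ≤ K → lieIdeal f p k = lieIdeal f p K :=
  monotone_stabilizes_iff_noetherian.mpr inferInstance
    ⟨lieIdeal f p, fun _ _ hab =>
      Ideal.span_mono fun _ ⟨i, hi, hq⟩ => ⟨i, hi.trans hab, hq⟩⟩

open Classical in
/-- `ord_f(p)`: the least index at which the chain `⟨p⟩ ⊆ ⟨p, p'⟩ ⊆ …` has stabilized. -/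
def ord {n : ℕ} (f : Fin n → MvPolynomial (Fin n) ℝ) (p : MvPolynomial (Fin n) ℝ) : ℕ :=
  Nat.find (exists_lieIdeal_stable f p)

/-! ### Multivariate division with remainder -/

theorem toWithBotSyn_lt {σ : Type*} (m : MonomialOrder σ) {g h : MvPolynomial σ ℝ} (hg : g ≠ 0)
    (hle : m.toSyn (m.degree h) ≤ m.toSyn (m.degree g)) (hc : h.coeff (m.degree g) = 0) :
    m.toWithBotSyn (m.withBotDegree h) < m.toWithBotSyn (m.withBotDegree g) := by
  rw [MonomialOrder.withBotDegree_lt_withBotDegree_iff]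
  by_cases hh : h = 0
  · exact Or.inr ⟨hh, hg⟩
  · refine Or.inl (lt_of_le_of_ne hle fun he => ?_)
    rw [m.toSyn.injective he.symm] at hc
    exact m.coeff_degree_ne_zero_iff.mpr hh hc

theorem divStep_lt {σ : Type*} (m : MonomialOrder σ) {g b : MvPolynomial σ ℝ} (hg : g ≠ 0)
    (hb : b ≠ 0) (hbg : m.degree b ≤ m.degree g) :
    m.toWithBotSyn (m.withBotDegree
      (g - monomial (m.degree g - m.degree b) (m.leadingCoeff g / m.leadingCoeff b) * b)) <
    m.toWithBotSyn (m.withBotDegree g) := by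
  have hlb : m.leadingCoeff b ≠ 0 := m.leadingCoeff_ne_zero_iff.mpr hb
  have hdeg : m.degree g - m.degree b + m.degree b = m.degree g := tsub_add_cancel_of_le hbg
  refine toWithBotSyn_lt m hg ?_ ?_
  · refine le_trans m.degree_sub_le (sup_le le_rfl ?_)
    refine le_trans m.degree_mul_le ?_
    rw [map_add]
    refine le_trans (add_le_add_left (m.degree_monomial_le _) _) ?_
    rw [← map_add, hdeg]
  · have h : coeff (m.degree g) (monomial (m.degree g - m.degree b)
        (m.leadingCoeff g / m.leadingCoeff b) * b) = m.leadingCoeff g := by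
      conv_lhs => rw [← hdeg, add_tsub_cancel_right, coeff_monomial_mul]
      exact div_mul_cancel₀ _ hlb
    rw [coeff_sub, h]
    exact sub_self _

theorem sub_leadingTerm_lt {σ : Type*} (m : MonomialOrder σ) {g : MvPolynomial σ ℝ}
    (hg : g ≠ 0) :
    m.toWithBotSyn (m.withBotDegree (g - m.leadingTerm g)) <
    m.toWithBotSyn (m.withBotDegree g) := by
  classical
  refine toWithBotSyn_lt m hg (m.degree_sub_leadingTerm_le g) ?_
  simp [MonomialOrder.leadingTerm, MonomialOrder.leadingCoeff, coeff_monomial]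

open Classical in
/-- The remainder of `g` on division by the polynomials in the list `B`, for the monomial order
`m`: as long as the leading monomial is divisible by that of a divisor, the first such divisor is
used to cancel the leading term; otherwise the leading term is moved to the remainder. -/
def divRem {σ : Type*} (m : MonomialOrder σ) (B : List (MvPolynomial σ ℝ))
    (g : MvPolynomial σ ℝ) : MvPolynomial σ ℝ :=
  if hg : g = 0 then 0
  else
    match hf : B.find? (fun b => decide (b ≠ 0 ∧ m.degree b ≤ m.degree g)) with
    | some b =>
        divRem m B
          (g - monomial (m.degree g - m.degree b) (m.leadingCoeff g / m.leadingCoeff b) * b)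
    | none => m.leadingTerm g + divRem m B (g - m.leadingTerm g)
termination_by WellFounded.wrap (wellFounded_lt (α := WithBot m.syn))
  (m.toWithBotSyn (m.withBotDegree g))
decreasing_by
  · have h := List.find?_some hf
    simp only [decide_eq_true_eq] at h
    exact divStep_lt m hg h.1 h.2
  · exact sub_leadingTerm_lt m hg

/-- `rem₀ = p`, and `remᵢ₊₁` is the remainder of the Lie derivative of `remᵢ` on division by
`rem₀, …, remᵢ`. -/
def lieRem {n : ℕ} (m : MonomialOrder (Fin n)) (f : Fin n → MvPolynomial (Fin n) ℝ)
    (p : MvPolynomial (Fin n) ℝ) : ℕ → MvPolynomial (Fin n) ℝ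
  | 0 => p
  | i + 1 =>
      divRem m (List.ofFn fun j : Fin (i + 1) => lieRem m f p j) (lieDeriv f (lieRem m f p i))
termination_by i => i
decreasing_by
  · exact j.isLt
  · exact Nat.lt_succ_self i

/-! ### The procedures `In`, `Exit`, `NonEmpty` and `ES` -/

section Procedures

variable {n : ℕ} (m : MonomialOrder (Fin n)) (f : Fin n → MvPolynomial (Fin n) ℝ)

/-- `rem₀ = 0 ∧ … ∧ remₖ₋₁ = 0`. -/
def remsVanish (p : MvPolynomial (Fin n) ℝ) (k : ℕ) : Formula n :=
  Formula.conj ((List.range k).map fun j => Formula.eq (lieRem m f p j))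

/-- `In_f` on atomic formulas. -/
def inAtom : Atom n → Formula n
  | .tt => Formula.tt
  | .ff => Formula.ff
  | .eq p => remsVanish m f p (ord f p + 1)
  | .lt p => Formula.disj ((List.range (ord f p + 1)).map fun i =>
      Formula.and (remsVanish m f p i) (Formula.lt (lieRem m f p i)))

/-- `In_f` on formulas: every atomic subformula `A` is replaced by `In_f(A)`. -/
def inFormula : Formula n → Formula n
  | .atom A => inAtom m f A
  | .and S₁ S₂ => .and (inFormula S₁) (inFormula S₂)
  | .or S₁ S₂ => .or (inFormula S₁) (inFormula S₂)
  | .not S => .not (inFormula S)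

/-- `Exit_f` on atomic formulas. For `p = 0` it is the disjunction over `1 ≤ i ≤ ord_f(p)` of
`rem₀ = 0 ∧ … ∧ remᵢ₋₁ = 0 ∧ remᵢ ≠ 0`. -/
def exitAtom : Atom n → Formula n
  | .tt => Formula.ff
  | .ff => Formula.ff
  | .lt _ => Formula.ff
  | .eq p => Formula.disj ((List.range (ord f p)).map fun i =>
      Formula.and (remsVanish m f p (i + 1)) (Formula.ne (lieRem m f p (i + 1))))

/-- `reduce` is a quantifier-elimination oracle: on input `φ` it decides the sentence
`∃ x₁ … ∃ xₙ, φ`. -/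
def IsReduceOracle (reduce : Formula n → Bool) : Prop :=
  ∀ φ, reduce φ = true ↔ ∃ x, x ∈ φ.toSet

/-- The recursive procedure `NonEmpty_f(S, R)`, with calls to the subroutine `reduce`. -/
def nonEmpty (reduce : Formula n → Bool) : Formula n → Formula n → Bool
  | .atom A, R => reduce (.and (exitAtom m f A) R)
  | .and S₁ S₂, R => nonEmpty reduce S₁ (.and S₂ R) || nonEmpty reduce S₂ (.and S₁ R)
  | .or S₁ S₂, R =>
      nonEmpty reduce S₁ (.and (.not (inFormula m f S₂)) R) ||
        nonEmpty reduce S₂ (.and (.not (inFormula m f S₁)) R)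
  | .not S, R => nonEmpty reduce S.neg R
termination_by S => S.weight
decreasing_by
  all_goals first
    | exact Formula.weight_neg_lt _
    | (simp only [Formula.weight]; omega)

/-- The procedure `ES(S, f) = ¬ (NonEmpty_f(S, T) ∨ NonEmpty_{-f}(¬ S, T))`. -/
def es (reduce : Formula n → Bool) (S : Formula n) : Bool :=
  !(nonEmpty m f reduce S Formula.tt || nonEmpty m (-f) reduce (.not S) Formula.tt)

end Procedures

end

end ExitSets

/-! Along a trajectory, the sign of `p` just after time 0 is the sign of the first nonzero value
among `p, p', p'', …` at the start. If these vanish up to order `ord f p`, then `p` vanishes along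
the trajectory for a while, since the derivatives solve a closed linear system. Remainders may
replace derivatives: modulo the earlier derivatives they agree (`lieRem_sub_iterate_mem`). Hence
every trajectory is, just after time 0, either entirely in `S` or entirely outside it, and
`inFormula` tells which (`eventually_mem_iff`).

So `S \ In_f(S)` consists of the points of `S` that leave at once, and `nonEmpty` tests whether it
is empty (`nonEmpty_iff`). A trajectory leaving `S` has a last moment: either it is in `S` then and
exits immediately, or it is outside, and the reversed trajectory immediately exits the complement.
Emptiness of the exit sets of `S` under `f` and of its complement under `-f` is therefore equivalent
to positive invariance. -/

namespace ExitSets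

open Filter Topology Set

/-! ### Lie derivatives, their ideals and the division remainders. -/

section LieDerivative

variable {n : ℕ} (f : Fin n → MvPolynomial (Fin n) ℝ)

theorem lieDeriv_add (p q : MvPolynomial (Fin n) ℝ) :
    lieDeriv f (p + q) = lieDeriv f p + lieDeriv f q := by
  simp [lieDeriv, add_mul, Finset.sum_add_distrib]

theorem lieDeriv_mul (p q : MvPolynomial (Fin n) ℝ) :
    lieDeriv f (p * q) = lieDeriv f p * q + p * lieDeriv f q := by
  simp only [lieDeriv, Derivation.leibniz, smul_eq_mul, Finset.sum_mul, Finset.mul_sum,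
    ← Finset.sum_add_distrib]
  exact Finset.sum_congr rfl fun i _ => by ring

theorem lieDeriv_zero : lieDeriv f 0 = 0 := by simp [lieDeriv]

theorem lieDeriv_C (a : ℝ) : lieDeriv f (C a) = 0 := by simp [lieDeriv]

theorem lieDeriv_X (i : Fin n) : lieDeriv f (X i) = f i := by
  classical
  simp [lieDeriv, pderiv_X, Pi.single_apply]

theorem lieDeriv_sub (p q : MvPolynomial (Fin n) ℝ) :
    lieDeriv f (p - q) = lieDeriv f p - lieDeriv f q := by
  simp [lieDeriv, sub_mul, Finset.sum_sub_distrib]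

/-- The ideal generated by the first `k` iterated Lie derivatives `p, p', …, p⁽ᵏ⁻¹⁾`. -/
noncomputable def lieIdealBelow (p : MvPolynomial (Fin n) ℝ) (k : ℕ) :
    Ideal (MvPolynomial (Fin n) ℝ) :=
  Ideal.span ((fun j => (lieDeriv f)^[j] p) '' Iio k)

theorem iterate_lieDeriv_mem_lieIdealBelow (p : MvPolynomial (Fin n) ℝ) {j k : ℕ} (h : j < k) :
    (lieDeriv f)^[j] p ∈ lieIdealBelow f p k :=
  Ideal.subset_span ⟨j, h, rfl⟩

theorem lieIdealBelow_mono (p : MvPolynomial (Fin n) ℝ) : Monotone (lieIdealBelow f p) :=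
  fun _ _ h => Ideal.span_mono (image_mono (Iio_subset_Iio h))

theorem lieDeriv_mem_lieIdealBelow (p : MvPolynomial (Fin n) ℝ) {k : ℕ}
    {q : MvPolynomial (Fin n) ℝ} (hq : q ∈ lieIdealBelow f p k) :
    lieDeriv f q ∈ lieIdealBelow f p (k + 1) := by
  induction hq using Submodule.span_induction with
  | mem q hq =>
    obtain ⟨j, hj, rfl⟩ := hq
    have := iterate_lieDeriv_mem_lieIdealBelow f p (Nat.succ_lt_succ hj)
    rwa [Function.iterate_succ_apply'] at this
  | zero => rw [lieDeriv_zero]; exact zero_mem _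
  | add q r _ _ hq hr => rw [lieDeriv_add]; exact add_mem hq hr
  | smul a q hq hq' =>
    rw [smul_eq_mul, lieDeriv_mul]
    exact add_mem (Ideal.mul_mem_left _ _ (lieIdealBelow_mono f p k.le_succ hq))
      (Ideal.mul_mem_left _ _ hq')

theorem sub_divRem_mem_span {σ : Type*} (m : MonomialOrder σ) (B : List (MvPolynomial σ ℝ))
    (g : MvPolynomial σ ℝ) : g - divRem m B g ∈ Ideal.span {b | b ∈ B} := by
  fun_induction divRem m B g with
  | case1 => simp
  | case2 g hg b hf ih =>
    have hb : b ∈ Ideal.span {b | b ∈ B} := Ideal.subset_span (List.mem_of_find?_eq_some hf)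
    have := add_mem ih (Ideal.mul_mem_left _
      (monomial (m.degree g - m.degree b) (m.leadingCoeff g / m.leadingCoeff b)) hb)
    convert this using 1
    ring
  | case3 g hg hf ih =>
    convert ih using 1
    ring

/-- Differentiating the congruence at `k` raises the ideal by one step, and division then changes
the result only by a combination of earlier remainders, which lie in that ideal by induction. Of the
division only `sub_divRem_mem_span` matters. -/
theorem lieRem_sub_iterate_mem (m : MonomialOrder (Fin n)) (p : MvPolynomial (Fin n) ℝ) (k : ℕ) :
    lieRem m f p k - (lieDeriv f)^[k] p ∈ lieIdealBelow f p k := by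
  induction k using Nat.strong_induction_on with
  | _ k ih =>
    cases k with
    | zero => simp [lieRem]
    | succ k =>
      have h₁ : Ideal.span {b | b ∈ List.ofFn fun j : Fin (k + 1) => lieRem m f p j} ≤
          lieIdealBelow f p (k + 1) := by
        refine Ideal.span_le.2 fun b hb => ?_
        obtain ⟨j, rfl⟩ := (List.mem_ofFn' _ _).1 hb
        have := add_mem (lieIdealBelow_mono f p j.isLt.le (ih j j.isLt))
          (iterate_lieDeriv_mem_lieIdealBelow f p j.isLt)
        simpa using this
      have h₂ := h₁ (sub_divRem_mem_span m _ (lieDeriv f (lieRem m f p k)))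
      have h₃ := lieDeriv_mem_lieIdealBelow f p (ih k k.lt_succ_self)
      rw [lieDeriv_sub] at h₃
      rw [lieRem, Function.iterate_succ_apply']
      convert sub_mem h₃ h₂ using 1
      ring

variable {f}

theorem eval_eq_zero_of_mem_lieIdealBelow {p q : MvPolynomial (Fin n) ℝ} {k : ℕ} {x : Fin n → ℝ}
    (hx : ∀ j < k, eval x ((lieDeriv f)^[j] p) = 0) (hq : q ∈ lieIdealBelow f p k) :
    eval x q = 0 := by
  have : lieIdealBelow f p k ≤ RingHom.ker (eval x) :=
    Ideal.span_le.2 (by rintro _ ⟨j, hj, rfl⟩; exact hx j hj)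
  exact this hq

theorem eval_lieRem_eq (m : MonomialOrder (Fin n)) {p : MvPolynomial (Fin n) ℝ} {k : ℕ}
    {x : Fin n → ℝ} (hx : ∀ j < k, eval x ((lieDeriv f)^[j] p) = 0) :
    eval x (lieRem m f p k) = eval x ((lieDeriv f)^[k] p) := by
  have := eval_eq_zero_of_mem_lieIdealBelow hx (lieRem_sub_iterate_mem f m p k)
  rwa [map_sub, sub_eq_zero] at this

theorem lieRems_vanish_iff (m : MonomialOrder (Fin n)) (p : MvPolynomial (Fin n) ℝ) (k : ℕ)
    (x : Fin n → ℝ) :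
    (∀ j < k, eval x (lieRem m f p j) = 0) ↔ ∀ j < k, eval x ((lieDeriv f)^[j] p) = 0 := by
  induction k with
  | zero => simp
  | succ k ih =>
    rw [Nat.forall_lt_succ_right, Nat.forall_lt_succ_right, ih]
    exact and_congr_right fun h => by rw [eval_lieRem_eq m h]

/-- Stabilization of the ideal chain closes the system: the next derivative depends linearly on the
previous ones. -/
theorem exists_iterate_lieDeriv_eq_sum (p : MvPolynomial (Fin n) ℝ) :
    ∃ c : Fin (ord f p + 1) → MvPolynomial (Fin n) ℝ,
      (lieDeriv f)^[ord f p + 1] p = ∑ j, c j * (lieDeriv f)^[j] p := by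
  classical
  have h : lieIdeal f p (ord f p) = lieIdeal f p (ord f p + 1) :=
    Nat.find_spec (exists_lieIdeal_stable f p) _ (Nat.le_succ _)
  have hmem : (lieDeriv f)^[ord f p + 1] p ∈ lieIdeal f p (ord f p) := by
    rw [h]
    exact Ideal.subset_span ⟨_, le_rfl, rfl⟩
  have hrange : {q | ∃ i ≤ ord f p, q = (lieDeriv f)^[i] p} =
      range fun j : Fin (ord f p + 1) => (lieDeriv f)^[j] p := by
    ext q
    constructor
    · rintro ⟨i, hi, rfl⟩
      exact ⟨⟨i, Nat.lt_succ_of_le hi⟩, rfl⟩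
    · rintro ⟨j, rfl⟩
      exact ⟨j, Nat.le_of_lt_succ j.isLt, rfl⟩
  rw [lieIdeal, hrange, Ideal.mem_span_range_iff_exists_fun] at hmem
  obtain ⟨c, hc⟩ := hmem
  exact ⟨c, hc.symm⟩

end LieDerivative

/-! ### Behaviour of polynomials along trajectories; existence, shift and reversal of solutions. -/

section Trajectories

variable {n : ℕ} {f : Fin n → MvPolynomial (Fin n) ℝ} {γ : ℝ → Fin n → ℝ}

theorem hasDerivAt_eval {t : ℝ} (h : HasDerivAt γ (vectorField f (γ t)) t)
    (p : MvPolynomial (Fin n) ℝ) :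
    HasDerivAt (fun s => eval (γ s) p) (eval (γ t) (lieDeriv f p)) t := by
  induction p using MvPolynomial.induction_on with
  | C a => simpa [lieDeriv_C] using hasDerivAt_const t a
  | add p q hp hq =>
    simp only [lieDeriv_add, map_add]
    exact hp.add hq
  | mul_X p i hp =>
    have hi : HasDerivAt (fun s => γ s i) (eval (γ t) (f i)) t := hasDerivAt_pi.1 h i
    simp only [lieDeriv_mul, lieDeriv_X, map_add, map_mul, eval_X]
    exact hp.mul hi

/-- If the first nonvanishing iterated Lie derivative at the initial point has the sign of `c`,
then so has `p` on the trajectory immediately after the initial time. -/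
theorem eventually_mul_eval_pos (hγ : IsIntegralCurveAt γ (fun _ => vectorField f) 0) {c : ℝ}
    (k : ℕ) (p : MvPolynomial (Fin n) ℝ) (hzero : ∀ j < k, eval (γ 0) ((lieDeriv f)^[j] p) = 0)
    (hpos : 0 < c * eval (γ 0) ((lieDeriv f)^[k] p)) :
    ∀ᶠ t in 𝓝[>] 0, 0 < c * eval (γ t) p := by
  induction k generalizing p with
  | zero =>
    have hcont := ((hasDerivAt_eval hγ.self_of_nhds p).const_mul c).continuousAt
    exact nhdsWithin_le_nhds (hcont.eventually (lt_mem_nhds hpos))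
  | succ k ih =>
    have hev := ih (lieDeriv f p) (fun j hj => by
      simpa using hzero (j + 1) (Nat.succ_lt_succ hj)) (by simpa using hpos)
    obtain ⟨ε, hε, hsub⟩ := mem_nhdsGT_iff_exists_Ioo_subset.1
      (hev.and (nhdsWithin_le_nhds hγ))
    refine mem_nhdsGT_iff_exists_Ioo_subset.2 ⟨ε, hε, fun t ht => ?_⟩
    have hderiv : ∀ s ∈ Ico 0 ε, HasDerivAt (fun s => c * eval (γ s) p)
        (c * eval (γ s) (lieDeriv f p)) s := fun s hs => by
      refine (hasDerivAt_eval ?_ p).const_mul c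
      rcases hs.1.eq_or_lt with rfl | h0
      · exact hγ.self_of_nhds
      · exact (hsub ⟨h0, hs.2⟩).2
    -- By induction `c * p'` is positive just after 0, so `c * p` increases strictly from its
    -- initial value 0.
    have hmono : StrictMonoOn (fun s => c * eval (γ s) p) (Ico 0 ε) := by
      refine strictMonoOn_of_deriv_pos (convex_Ico 0 ε)
        (fun s hs => (hderiv s hs).continuousAt.continuousWithinAt) fun s hs => ?_
      rw [interior_Ico] at hs
      rw [(hderiv s (Ioo_subset_Ico_self hs)).deriv]
      exact (hsub hs).1
    have h0 : eval (γ 0) p = 0 := hzero 0 (Nat.succ_pos k)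
    have := hmono ⟨le_rfl, hε⟩ (Ioo_subset_Ico_self ht) ht.1
    simpa [h0] using this

/-- The vector of derivatives up to order `ord f p` solves a linear system with continuous
coefficients and starts at 0, so a Grönwall estimate keeps it 0. -/
theorem eventually_eval_eq_zero (hγ : IsIntegralCurveAt γ (fun _ => vectorField f) 0)
    (p : MvPolynomial (Fin n) ℝ)
    (hzero : ∀ j < ord f p + 1, eval (γ 0) ((lieDeriv f)^[j] p) = 0) :
    ∀ᶠ t in 𝓝[>] 0, eval (γ t) p = 0 := by
  have hsum := exists_iterate_lieDeriv_eq_sum (f := f) p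
  generalize ord f p = N at hsum hzero
  obtain ⟨c, hc⟩ := hsum
  obtain ⟨ε, hε, hsub⟩ := Metric.eventually_nhds_iff.1 hγ
  have hderiv : ∀ s ∈ Icc 0 (ε / 2), HasDerivAt γ (vectorField f (γ s)) s := fun s hs => by
    refine hsub ?_
    rw [Real.dist_eq, sub_zero, abs_of_nonneg hs.1]
    linarith [hs.2]
  have hcont : ∀ q : MvPolynomial (Fin n) ℝ, ContinuousOn (fun s => eval (γ s) q)
      (Icc 0 (ε / 2)) := fun q s hs =>
    (hasDerivAt_eval (hderiv s hs) q).continuousAt.continuousWithinAt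
  obtain ⟨K, hK⟩ := isCompact_Icc.exists_bound_of_continuousOn
    (continuousOn_finsetSum Finset.univ fun j _ => (hcont (c j)).abs)
  have hvec : ∀ t ∈ Icc 0 (ε / 2),
      (fun j : Fin (N + 1) => eval (γ t) ((lieDeriv f)^[j] p)) = 0 := by
    refine eq_zero_of_abs_deriv_le_mul_abs_self_of_eq_zero_right
      -- In the constant, 1 serves the rows whose derivative is the next entry, and `K`, a bound for
      -- the sum of the coefficients' absolute values, serves the last row.
      (f' := fun t (j : Fin (N + 1)) => eval (γ t) ((lieDeriv f)^[j + 1] p)) (K := max 1 K)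
      (continuousOn_pi.2 fun j => hcont _) (fun t ht => ?_) (funext fun j => hzero j j.isLt)
      fun t ht => ?_
    · refine HasDerivAt.hasDerivWithinAt (hasDerivAt_pi.2 fun j => ?_)
      rw [Function.iterate_succ_apply']
      exact hasDerivAt_eval (hderiv t (Ico_subset_Icc_self ht)) _
    · set y : Fin (N + 1) → ℝ := fun j => eval (γ t) ((lieDeriv f)^[j] p) with hy
      refine (pi_norm_le_iff_of_nonneg (by positivity)).2 fun j => ?_
      rcases (Nat.le_of_lt_succ j.isLt).lt_or_eq with hj | hj
      · calc ‖eval (γ t) ((lieDeriv f)^[j + 1] p)‖ = ‖y ⟨j + 1, by omega⟩‖ := rfl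
          _ ≤ 1 * ‖y‖ := by rw [one_mul]; exact norm_le_pi_norm y _
          _ ≤ max 1 K * ‖y‖ := by gcongr; exact le_max_left _ _
      · have hK' := hK t (Ico_subset_Icc_self ht)
        rw [hj, hc, map_sum]
        calc ‖∑ i, eval (γ t) (c i * (lieDeriv f)^[i] p)‖
            ≤ ∑ i, ‖eval (γ t) (c i * (lieDeriv f)^[i] p)‖ := norm_sum_le _ _
          _ ≤ ∑ i, |eval (γ t) (c i)| * ‖y‖ := by
            refine Finset.sum_le_sum fun i _ => ?_
            rw [map_mul, norm_mul, Real.norm_eq_abs]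
            gcongr
            exact norm_le_pi_norm y i
          _ ≤ K * ‖y‖ := by
            rw [← Finset.sum_mul]
            gcongr
            exact (le_abs_self _).trans hK'
          _ ≤ max 1 K * ‖y‖ := by gcongr; exact le_max_right _ _
  refine mem_nhdsGT_iff_exists_Ioo_subset.2 ⟨ε / 2, half_pos hε, fun t ht => ?_⟩
  exact congrFun (hvec t (Ioo_subset_Icc_self ht)) 0

theorem contDiff_eval (p : MvPolynomial (Fin n) ℝ) :
    ContDiff ℝ 1 fun x : Fin n → ℝ => eval x p := by
  induction p using MvPolynomial.induction_on with
  | C a => simpa using contDiff_const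
  | add p q hp hq => simpa using hp.add hq
  | mul_X p i hp => simpa using hp.mul (contDiff_apply ℝ ℝ i)

theorem exists_isSolution (f : Fin n → MvPolynomial (Fin n) ℝ) (x : Fin n → ℝ) :
    ∃ J γ, IsSolution f x J γ := by
  have hf : ContDiff ℝ 1 (vectorField f) := contDiff_pi.2 fun i => contDiff_eval (f i)
  obtain ⟨γ, h0, ε, hε, hγ⟩ :=
    hf.contDiffAt.exists_forall_mem_closedBall_exists_eq_forall_mem_Ioo_hasDerivAt₀
      (x₀ := x) 0
  exact ⟨Ioo (0 - ε) (0 + ε), γ, isOpen_Ioo, ordConnected_Ioo, by simpa using hε, h0,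
    fun t ht => (hγ t ht).hasDerivWithinAt⟩

namespace IsSolution

variable {x : Fin n → ℝ} {J : Set ℝ}

theorem hasDerivAt (h : IsSolution f x J γ) {t : ℝ} (ht : t ∈ J) :
    HasDerivAt γ (vectorField f (γ t)) t :=
  (h.2.2.2.2 t ht).hasDerivAt (h.1.mem_nhds ht)

/-- The time shift of a solution is a solution. -/
theorem shift (h : IsSolution f x J γ) {s : ℝ} (hs : s ∈ J) :
    IsSolution f (γ s) ((fun t => s + t) ⁻¹' J) (fun t => γ (s + t)) := by
  refine ⟨h.1.preimage (by fun_prop), ⟨fun a ha b hb t ht => ?_⟩, by simpa, by simp,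
    fun t ht => ?_⟩
  · exact h.2.1.out ha hb ⟨add_le_add_right ht.1 s, add_le_add_right ht.2 s⟩
  · exact (HasDerivAt.comp_const_add s t (h.hasDerivAt ht)).hasDerivWithinAt

/-- The time reversal of a solution is a solution of the opposite system. -/
theorem reverse (h : IsSolution f x J γ) :
    IsSolution (-f) x ((fun t => -t) ⁻¹' J) (fun t => γ (-t)) := by
  obtain ⟨ho, hc, h0, hx, -⟩ := id h
  refine ⟨ho.preimage (by fun_prop), ⟨fun a ha b hb t ht => ?_⟩, by simpa, by simpa,
    fun t ht => ?_⟩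
  · exact hc.out hb ha ⟨neg_le_neg ht.2, neg_le_neg ht.1⟩
  · have := (h.hasDerivAt (t := -t) ht).scomp t (hasDerivAt_neg t)
    refine (this.congr_deriv ?_).hasDerivWithinAt
    ext i
    simp [vectorField]

theorem isIntegralCurveAt (h : IsSolution f x J γ) :
    IsIntegralCurveAt γ (fun _ => vectorField f) 0 :=
  mem_of_superset (h.1.mem_nhds h.2.2.1) fun _ ht => h.hasDerivAt ht

end IsSolution

end Trajectories

/-! ### Semantics of the formulas and correctness of the procedures. -/

section Formulas

variable {n : ℕ}

namespace Formula

@[simp] theorem mem_tt (x : Fin n → ℝ) : x ∈ (tt : Formula n).toSet := mem_univ x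

@[simp] theorem notMem_ff (x : Fin n → ℝ) : x ∉ (ff : Formula n).toSet := notMem_empty x

@[simp] theorem mem_lt {p : MvPolynomial (Fin n) ℝ} {x : Fin n → ℝ} :
    x ∈ (lt p).toSet ↔ eval x p < 0 := Iff.rfl

@[simp] theorem mem_eq {p : MvPolynomial (Fin n) ℝ} {x : Fin n → ℝ} :
    x ∈ (eq p).toSet ↔ eval x p = 0 := Iff.rfl

@[simp] theorem mem_and {S₁ S₂ : Formula n} {x : Fin n → ℝ} :
    x ∈ (and S₁ S₂).toSet ↔ x ∈ S₁.toSet ∧ x ∈ S₂.toSet := Iff.rfl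

@[simp] theorem mem_or {S₁ S₂ : Formula n} {x : Fin n → ℝ} :
    x ∈ (or S₁ S₂).toSet ↔ x ∈ S₁.toSet ∨ x ∈ S₂.toSet := Iff.rfl

@[simp] theorem mem_not {S : Formula n} {x : Fin n → ℝ} :
    x ∈ (not S).toSet ↔ x ∉ S.toSet := Iff.rfl

@[simp] theorem mem_ne {p : MvPolynomial (Fin n) ℝ} {x : Fin n → ℝ} :
    x ∈ (ne p).toSet ↔ eval x p ≠ 0 := by
  rw [ne, mem_or, mem_lt, mem_lt, map_neg, neg_lt_zero, ne_iff_lt_or_gt, or_comm]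

@[simp] theorem mem_conj {L : List (Formula n)} {x : Fin n → ℝ} :
    x ∈ (conj L).toSet ↔ ∀ S ∈ L, x ∈ S.toSet := by
  induction L with
  | nil => simp [conj]
  | cons S L ih => simp only [List.forall_mem_cons, ← ih]; rfl

@[simp] theorem mem_disj {L : List (Formula n)} {x : Fin n → ℝ} :
    x ∈ (disj L).toSet ↔ ∃ S ∈ L, x ∈ S.toSet := by
  induction L with
  | nil => simp [disj]
  | cons S L ih => simp only [List.exists_mem_cons_iff, ← ih]; rfl

@[simp] theorem mem_neg {S : Formula n} {x : Fin n → ℝ} :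
    x ∈ (neg S).toSet ↔ x ∉ S.toSet := by
  rcases S with (_ | _ | p | p) | ⟨S₁, S₂⟩ | ⟨S₁, S₂⟩ | S
  · exact iff_of_false (notMem_ff x) (not_not.2 (mem_tt x))
  · exact iff_of_true (mem_tt x) (notMem_ff x)
  · change x ∈ (or (lt (-p)) (eq (-p))).toSet ↔ x ∉ (lt p).toSet
    simp [le_iff_lt_or_eq, eq_comm]
  · exact mem_ne
  · simp [neg, imp_iff_not_or]
  · simp [neg]
  · simp [neg]

end Formula

variable (m : MonomialOrder (Fin n)) (f : Fin n → MvPolynomial (Fin n) ℝ)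

@[simp] theorem mem_remsVanish {p : MvPolynomial (Fin n) ℝ} {k : ℕ} {x : Fin n → ℝ} :
    x ∈ (remsVanish m f p k).toSet ↔ ∀ j < k, eval x (lieRem m f p j) = 0 := by
  simp [remsVanish]

theorem mem_inAtom_lt {p : MvPolynomial (Fin n) ℝ} {x : Fin n → ℝ} :
    x ∈ (inAtom m f (.lt p)).toSet ↔ ∃ i < ord f p + 1,
      (∀ j < i, eval x (lieRem m f p j) = 0) ∧ eval x (lieRem m f p i) < 0 := by
  simp [inAtom]

theorem mem_inAtom_eq {p : MvPolynomial (Fin n) ℝ} {x : Fin n → ℝ} :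
    x ∈ (inAtom m f (.eq p)).toSet ↔ ∀ j < ord f p + 1, eval x (lieRem m f p j) = 0 :=
  mem_remsVanish m f

theorem exists_first_ne_zero {α : Type*} [Zero α] {u : ℕ → α} {k : ℕ}
    (h : ¬ ∀ j < k, u j = 0) : ∃ i < k, (∀ j < i, u j = 0) ∧ u i ≠ 0 := by
  classical
  push Not at h
  obtain ⟨hlt, hne⟩ := Nat.find_spec h
  refine ⟨Nat.find h, hlt, fun j hj => ?_, hne⟩
  by_contra hj0
  exact Nat.find_min h hj ⟨hj.trans hlt, hj0⟩

theorem mem_exitAtom (A : Atom n) (x : Fin n → ℝ) :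
    x ∈ (exitAtom m f A).toSet ↔ x ∈ A.toSet ∧ x ∉ (inAtom m f A).toSet := by
  rcases A with _ | _ | p | p
  · exact iff_of_false (Formula.notMem_ff x) fun h => h.2 (Formula.mem_tt x)
  · exact iff_of_false (Formula.notMem_ff x) fun h => h.1
  · refine iff_of_false (Formula.notMem_ff x) fun h => h.2 ((mem_inAtom_lt m f).2 ?_)
    refine ⟨0, Nat.succ_pos _, by simp, ?_⟩
    rw [lieRem]
    exact h.1
  · rw [mem_inAtom_eq]
    simp only [exitAtom, Formula.mem_disj, List.mem_map, List.mem_range, exists_exists_and_eq_and,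
      Formula.mem_and, mem_remsVanish, Formula.mem_ne]
    constructor
    · rintro ⟨i, hi, hz, hne⟩
      refine ⟨?_, fun h => hne (h _ (by omega))⟩
      have := hz 0 (Nat.succ_pos i)
      rwa [lieRem] at this
    · rintro ⟨h0, h⟩
      obtain ⟨i, hi, hz, hne⟩ := exists_first_ne_zero h
      cases i with
      | zero => rw [lieRem] at hne; exact absurd h0 hne
      -- The disjunction is indexed from 0, with index `i` standing for remainder `i + 1`.
      | succ i => exact ⟨i, by omega, hz, hne⟩

variable {f}

theorem eventually_mem_atom_iff {γ : ℝ → Fin n → ℝ}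
    (hγ : IsIntegralCurveAt γ (fun _ => vectorField f) 0) (A : Atom n) :
    ∀ᶠ t in 𝓝[>] 0, (γ t ∈ A.toSet ↔ γ 0 ∈ (inAtom m f A).toSet) := by
  -- Either all remainders vanish, or the first nonzero one fixes the sign of `p` just after 0.
  have key : ∀ p, (∀ j < ord f p + 1, eval (γ 0) (lieRem m f p j) = 0) ∨
      ∃ i < ord f p + 1, (∀ j < i, eval (γ 0) (lieRem m f p j) = 0) ∧
        eval (γ 0) (lieRem m f p i) ≠ 0 ∧
        ∀ᶠ t in 𝓝[>] 0, 0 < eval (γ 0) (lieRem m f p i) * eval (γ t) p := fun p => by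
    refine or_iff_not_imp_left.2 fun h => ?_
    obtain ⟨i, hi, hz, hne⟩ := exists_first_ne_zero h
    have hz' := (lieRems_vanish_iff m p i (γ 0)).1 hz
    refine ⟨i, hi, hz, hne, eventually_mul_eval_pos hγ i p hz' ?_⟩
    rw [← eval_lieRem_eq m hz']
    exact mul_self_pos.2 hne
  rcases A with _ | _ | p | p
  · exact Eventually.of_forall fun t => iff_of_true (mem_univ _) (mem_univ _)
  · exact Eventually.of_forall fun t => iff_of_false (notMem_empty _) (notMem_empty _)
  · rw [mem_inAtom_lt]
    rcases key p with h | ⟨i, hi, hz, hne, hev⟩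
    · filter_upwards [eventually_eval_eq_zero hγ p ((lieRems_vanish_iff m p _ _).1 h)] with t ht
      refine iff_of_false ht.not_lt ?_
      rintro ⟨i, hi, -, hlt⟩
      exact hlt.ne (h i hi)
    · filter_upwards [hev] with t ht
      change eval (γ t) p < 0 ↔ _
      constructor
      · intro hlt
        exact ⟨i, hi, hz, (neg_iff_neg_of_mul_pos ht).2 hlt⟩
      · rintro ⟨k, hk, hkz, hlt⟩
        have hik : i = k := by
          rcases lt_trichotomy i k with h | h | h
          · exact absurd (hkz i h) hne
          · exact h
          · exact absurd (hz k h) hlt.ne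
        subst hik
        exact (neg_iff_neg_of_mul_pos ht).1 hlt
  · rw [mem_inAtom_eq]
    rcases key p with h | ⟨i, hi, hz, hne, hev⟩
    · filter_upwards [eventually_eval_eq_zero hγ p ((lieRems_vanish_iff m p _ _).1 h)] with t ht
      exact iff_of_true ht h
    · filter_upwards [hev] with t ht
      refine iff_of_false (fun h0 => ?_) fun h => hne (h i hi)
      rw [show eval (γ t) p = 0 from h0, mul_zero] at ht
      exact ht.false

/-- `In_f(S)` describes the initial points whose trajectory is immediately inside `S`; the
trajectories of the other points are immediately outside. -/
theorem eventually_mem_iff {γ : ℝ → Fin n → ℝ}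
    (hγ : IsIntegralCurveAt γ (fun _ => vectorField f) 0) (S : Formula n) :
    ∀ᶠ t in 𝓝[>] 0, (γ t ∈ S.toSet ↔ γ 0 ∈ (inFormula m f S).toSet) := by
  induction S with
  | atom A => exact eventually_mem_atom_iff m hγ A
  | and S₁ S₂ h₁ h₂ => filter_upwards [h₁, h₂] with t h₁ h₂ using and_congr h₁ h₂
  | or S₁ S₂ h₁ h₂ => filter_upwards [h₁, h₂] with t h₁ h₂ using or_congr h₁ h₂
  | not S h => filter_upwards [h] with t h using not_congr h

variable (f)

/-- On atoms this is not a formal identity; it holds because both sides are read off from one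
trajectory through `x` at a common small positive time. -/
theorem mem_inFormula_neg (S : Formula n) (x : Fin n → ℝ) :
    x ∈ (inFormula m f S.neg).toSet ↔ x ∉ (inFormula m f S).toSet := by
  obtain ⟨J, γ, hγ⟩ := exists_isSolution f x
  obtain ⟨t, h₁, h₂⟩ := ((eventually_mem_iff m hγ.isIntegralCurveAt S.neg).and
    (eventually_mem_iff m hγ.isIntegralCurveAt S)).exists
  rw [hγ.2.2.2.1] at h₁ h₂
  rw [← h₁, ← h₂, Formula.mem_neg]

/-- `NonEmpty_f(S, R)` decides whether `R` meets the exit set `S \ In_f(S)`. -/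
theorem nonEmpty_iff {reduce : Formula n → Bool} (hreduce : IsReduceOracle reduce)
    (S R : Formula n) : nonEmpty m f reduce S R = true ↔
      ∃ x, (x ∈ S.toSet ∧ x ∉ (inFormula m f S).toSet) ∧ x ∈ R.toSet := by
  fun_induction nonEmpty m f reduce S R with
  | case1 A R =>
    rw [hreduce]
    exact exists_congr fun x => and_congr_left fun _ => mem_exitAtom m f A x
  | case2 S₁ S₂ R ih₁ ih₂ =>
    rw [Bool.or_eq_true, ih₁, ih₂, ← exists_or]
    refine exists_congr fun x => ?_
    simp only [inFormula, Formula.mem_and]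
    tauto
  | case3 S₁ S₂ R ih₁ ih₂ =>
    rw [Bool.or_eq_true, ih₁, ih₂, ← exists_or]
    refine exists_congr fun x => ?_
    simp only [inFormula, Formula.mem_and, Formula.mem_or, Formula.mem_not]
    tauto
  | case4 S R ih =>
    rw [ih]
    simp only [inFormula, Formula.mem_neg, Formula.mem_not, mem_inFormula_neg]

theorem PositivelyInvariant.subset_inFormula {S : Formula n} (h : PositivelyInvariant f S.toSet) :
    S.toSet ⊆ (inFormula m f S).toSet := by
  intro x hx
  obtain ⟨J, γ, hγ⟩ := exists_isSolution f x
  have hJ : ∀ᶠ t in 𝓝[>] (0 : ℝ), t ∈ J ∧ 0 < t :=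
    Eventually.and (mem_nhdsWithin_of_mem_nhds (hγ.1.mem_nhds hγ.2.2.1)) self_mem_nhdsWithin
  obtain ⟨t, hiff, htJ, ht⟩ := ((eventually_mem_iff m hγ.isIntegralCurveAt S).and hJ).exists
  rw [hγ.2.2.2.1] at hiff
  exact hiff.1 (h x hx J γ hγ t htJ ht.le)

/-- If a backward trajectory entered `S`, retracing it forward would bring its starting point into
`S`. -/
theorem PositivelyInvariant.compl {S : Set (Fin n → ℝ)} (h : PositivelyInvariant f S) :
    PositivelyInvariant (-f) Sᶜ := by
  intro x hx J γ hγ t ht ht0 hmem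
  have hrev := (hγ.shift ht).reverse
  rw [neg_neg] at hrev
  have := h _ hmem _ _ hrev t (by simpa using hγ.2.2.1) ht0
  rw [add_neg_cancel, hγ.2.2.2.1] at this
  exact hx this

theorem positivelyInvariant_of_subset_inFormula {S : Formula n}
    (h₁ : S.toSet ⊆ (inFormula m f S).toSet)
    (h₂ : S.toSetᶜ ⊆ (inFormula m (-f) (.not S)).toSet) : PositivelyInvariant f S.toSet := by
  intro x hx J γ hγ t ht ht0
  have hJ : Icc 0 t ⊆ J := hγ.2.1.out hγ.2.2.1 ht
  -- Real induction: the supremum of the times up to which the trajectory has stayed in `S` is shown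
  -- to be `t`.
  set B : Set ℝ := {s | s ∈ Icc 0 t ∧ ∀ r ∈ Icc 0 s, γ r ∈ S.toSet} with hB
  have h0B : (0 : ℝ) ∈ B := ⟨⟨le_rfl, ht0⟩, fun r hr => by
    rw [le_antisymm hr.2 hr.1, hγ.2.2.2.1]; exact hx⟩
  have hBdd : BddAbove B := ⟨t, fun s hs => hs.1.2⟩
  set s := sSup B with hs
  have hs0 : 0 ≤ s := le_csSup hBdd h0B
  have hst : s ≤ t := csSup_le ⟨0, h0B⟩ fun r hr => hr.1.2
  have hbelow : ∀ r ∈ Ico 0 s, γ r ∈ S.toSet := fun r hr => by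
    obtain ⟨b, hb, hrb⟩ := exists_lt_of_lt_csSup ⟨0, h0B⟩ hr.2
    exact hb.2 r ⟨hr.1, hrb.le⟩
  have hsol := hγ.shift (hJ ⟨hs0, hst⟩)
  -- Otherwise `h₂`, applied to the reversed trajectory from `γ s`, puts it outside `S` just before
  -- `s`.
  have hsS : γ s ∈ S.toSet := by
    by_contra hsS
    have hpos : 0 < s := lt_of_le_of_ne hs0 fun h => hsS (by
      rw [← h, hγ.2.2.2.1]; exact hx)
    have hev := eventually_mem_iff m hsol.reverse.isIntegralCurveAt (.not S)
    obtain ⟨r, hiff, hr⟩ := (hev.and (Ioo_mem_nhdsGT hpos)).exists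
    simp only [neg_zero, add_zero] at hiff
    exact hiff.2 (h₂ hsS) (hbelow _ ⟨by linarith [hr.2], by linarith [hr.1]⟩)
  rcases hst.eq_or_lt with hst | hst
  · rwa [hst] at hsS
  -- By `h₁` the trajectory stays in `S` a little beyond `s`, against the choice of the supremum.
  · have hev := eventually_mem_iff m hsol.isIntegralCurveAt S
    simp only [add_zero, iff_true_right (h₁ hsS)] at hev
    obtain ⟨ε, hε, hsub⟩ := mem_nhdsGT_iff_exists_Ioo_subset.1
      (hev.and (Ioo_mem_nhdsGT (sub_pos.2 hst)))
    rw [mem_Ioi] at hε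
    have hmid := hsub (show ε / 2 ∈ Ioo 0 ε from ⟨half_pos hε, half_lt_self hε⟩)
    have : s + ε / 2 ∈ B := by
      refine ⟨⟨by positivity, by linarith [hmid.2.2]⟩, fun r hr => ?_⟩
      rcases lt_trichotomy r s with hrs | rfl | hrs
      · exact hbelow r ⟨hr.1, hrs⟩
      · exact hsS
      · have := (hsub (show r - s ∈ Ioo 0 ε from
          ⟨sub_pos.2 hrs, by linarith [hr.2]⟩)).1
        simpa using this
    linarith [le_csSup hBdd this]

theorem positivelyInvariant_iff_not_nonEmpty {reduce : Formula n → Bool}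
    (hreduce : IsReduceOracle reduce) (S : Formula n) : PositivelyInvariant f S.toSet ↔
      ¬ (nonEmpty m f reduce S .tt = true ∨ nonEmpty m (-f) reduce (.not S) .tt = true) := by
  have hsub : ∀ (g : Fin n → MvPolynomial (Fin n) ℝ) (T : Formula n),
      ¬ nonEmpty m g reduce T .tt = true ↔ T.toSet ⊆ (inFormula m g T).toSet := fun g T => by
    rw [nonEmpty_iff m g hreduce]
    simp [subset_def]
  rw [not_or, hsub, hsub]
  exact ⟨fun h => ⟨h.subset_inFormula m f, (h.compl f).subset_inFormula m (-f) (S := .not S)⟩,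
    fun h => positivelyInvariant_of_subset_inFormula m f h.1 h.2⟩

end Formulas

end ExitSets

theorem mainTheorem2 {n : ℕ} (f : Fin n → MvPolynomial (Fin n) ℝ) (S : ExitSets.Formula n)
    (m : MonomialOrder (Fin n))
    (reduce : ExitSets.Formula n → Bool) (hreduce : ExitSets.IsReduceOracle reduce) :
    (ExitSets.PositivelyInvariant f S.toSet ↔
      ¬ (ExitSets.nonEmpty m f reduce S ExitSets.Formula.tt = true ∨
        ExitSets.nonEmpty m (-f) reduce (ExitSets.Formula.not S) ExitSets.Formula.tt = true)) ∧
    (ExitSets.es m f reduce S = true ↔ ExitSets.PositivelyInvariant f S.toSet) := by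
  have h := ExitSets.positivelyInvariant_iff_not_nonEmpty m f hreduce S
  refine ⟨h, ?_⟩
  rw [h, ExitSets.es, Bool.not_eq_true', ← Bool.not_eq_true, Bool.or_eq_true]
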